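/- **Theorem (consistency of the simulation-based estimator).** Let $\Theta\subset\mathbb R^q$ be compact and let $\theta_0$ be an interior point of $\Theta$. For each $\theta\in\Theta$ let $(X_j(\theta))_{j\in\mathbb Z}$ be a (strictly) stationary real-valued time series, and let the observed series $X_j=X_j(\theta_0)$, $j\in\mathbb Z$, be stationary and ergodic. Fix $p\in\mathbb N$, put $\mathbf X_j(\theta)=(X_j(\theta),\dots,X_{j+p-1}(\theta))$, $\mathbf X_j=\mathbf X_j(\theta_0)$ and $\varphi(t,\theta)=\mathbb E\,e^{i\langle t,\mathbf X_1(\theta)\rangle}$ for $t\in\mathbb R^p$, and assume that the parameter is identified by this characteristic function: if $\theta\in\Theta$ and $\varphi(\cdot,\theta)=\varphi(\cdot,\theta_0)$, then $\theta=\theta_0$. Let $(\tilde{\mathbf X}_j(\theta),\ \theta\in\Theta)$, $j=1,2,\dots$, be iid $\mathbb R^p$-valued random functions of $\theta$, independent of the observed series, such that $\tilde{\mathbf X}_j(\theta)$ has the same distribution as $\mathbf X_1(\theta)$ for all $j$ and all $\theta\in\Theta$, and such that, for each $j$, the map $\theta\mapsto\tilde{\mathbf X}_j(\theta)$ is almost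 surely continuous on $\Theta$. Let $w:\mathbb R^p\to[0,\infty)$ be a weight function with $\int_{\mathbb R^p}w(t)\,dt<\infty$ and $\int_U w(t)\,dt>0$ for every nonempty open $U\subset\mathbb R^p$. For $n,H\in\mathbb N$ define $$Q_{n,H}(\theta)=\int_{\mathbb R^p}\Big|\frac1n\sum_{j=1}^n e^{i\langle t,\mathbf X_j\rangle}-\frac1H\sum_{j=1}^H e^{i\langle t,\tilde{\mathbf X}_j(\theta)\rangle}\Big|^2w(t)\,dt,\qquad\theta\in\Theta.$$ Let $H=H(n)\to\infty$ as $n\to\infty$, and let $\hat\theta_{n,H}\in\Theta$ be any minimizer of $Q_{n,H(n)}$ over $\Theta$. Then $\hat\theta_{n,H}\to\theta_0$ almost surely as $n\to\infty$. -/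

import Mathlib

open MeasureTheory ProbabilityTheory Filter Topology

noncomputable section

/-- The left shift `(x_j)_{j ∈ ℤ} ↦ (x_{j+1})_{j ∈ ℤ}` on two-sided real sequences. -/
def seqShift (x : ℤ → ℝ) : ℤ → ℝ := fun j => x (j + 1)

/-- The law of a real time series `(X_j)_{j ∈ ℤ}` on the sequence space `ℝ^ℤ`
(with the product σ-algebra). -/
def seriesLaw {Ω : Type*} [MeasurableSpace Ω] (P : Measure Ω) (X : ℤ → Ω → ℝ) :
    Measure (ℤ → ℝ) :=
  P.map (fun ω j => X j ω)

/-- Strict stationarity: the law of the series is invariant under the shift. -/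
def IsStationarySeries {Ω : Type*} [MeasurableSpace Ω] (P : Measure Ω) (X : ℤ → Ω → ℝ) : Prop :=
  MeasurePreserving seqShift (seriesLaw P X) (seriesLaw P X)

/-- A (strictly) stationary and ergodic series: the shift preserves the law of the series
and is ergodic for it. -/
def IsStationaryErgodicSeries {Ω : Type*} [MeasurableSpace Ω] (P : Measure Ω)
    (X : ℤ → Ω → ℝ) : Prop :=
  Ergodic seqShift (seriesLaw P X)

/-- The block `(X_j, …, X_{j+p-1})` at the sample point `ω`, a vector of `ℝ^p`. -/
def seriesBlock {Ω : Type*} (p : ℕ) (X : ℤ → Ω → ℝ) (j : ℤ) (ω : Ω) :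
    EuclideanSpace ℝ (Fin p) :=
  WithLp.toLp 2 (fun k : Fin p => X (j + (k : ℕ)) ω)

/-- The chf `t ↦ (1/N) ∑ exp(i⟨t, x_j⟩)` of the empirical distribution of the `N` points
`x_0, …, x_{N-1}` of `ℝ^p`. -/
def empiricalChf {p : ℕ} (N : ℕ) (x : ℕ → EuclideanSpace ℝ (Fin p))
    (t : EuclideanSpace ℝ (Fin p)) : ℂ :=
  (1 / (N : ℂ)) * ∑ j ∈ Finset.range N, Complex.exp ((inner ℝ t (x j) : ℝ) * Complex.I)

/-- `φ(t, θ) = E exp(i⟨t, 𝐗_1(θ)⟩)`, where `𝐗_1(θ) = (X_1(θ), …, X_p(θ))`. -/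
def modelChf {Ω Θ : Type*} [MeasurableSpace Ω] (P : Measure Ω) (p : ℕ) (X : Θ → ℤ → Ω → ℝ)
    (t : EuclideanSpace ℝ (Fin p)) (θ : Θ) : ℂ :=
  charFun (P.map (seriesBlock p (X θ) 1)) t

/-- The criterion `Q_{n,H}(θ) = ∫ |φ_n(t) - φ_H(t, θ)|² w(t) dt` at the sample point `ω`.
Here `φ_n` is the empirical chf of the blocks `𝐗_1, …, 𝐗_n` of the observed series `Xobs`, and
`φ_H(·, θ)` is that of `H` simulated blocks (numbered from `0`). -/
def simCriterion {Ω Θ : Type*} {p : ℕ} (w : EuclideanSpace ℝ (Fin p) → ℝ)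
    (Xobs : ℤ → Ω → ℝ) (Xsim : ℕ → Θ → Ω → EuclideanSpace ℝ (Fin p))
    (n H : ℕ) (ω : Ω) (θ : Θ) : ℝ :=
  ∫ t, ‖empiricalChf n (fun j => seriesBlock p Xobs ((j : ℤ) + 1) ω) t
      - empiricalChf H (fun j => Xsim j θ ω) t‖ ^ 2 * w t

end

/-!
The proof is Wald's consistency argument, run on the criterion as a squared `L²(W)` distance, where
`W` is the finite measure `w(t) dt`.

At the true parameter the criterion tends to `0`: the empirical chf of the observed blocks and that
of the simulated blocks both converge to `φ(·, θ₀)` almost surely at each fixed `t`, by Birkhoff's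
pointwise ergodic theorem (`ae_tendsto_birkhoffAverage`) and by the strong law of large numbers, and
Fubini together with dominated convergence turns this into almost sure convergence in `L²(W)`
(`ae_tendsto_integral_norm_empiricalChf_sub_sq`). Since the estimator minimizes the criterion, the
criterion at the estimator tends to `0` as well, so the simulated chf at the estimator tends to
`φ(·, θ₀)` in `L²(W)`.

This keeps the estimator away from every `θ ≠ θ₀`. Put `g = conj (φ(·, θ) - φ(·, θ₀))` and
`f(x) = Re ∫ exp(i⟨t, x⟩) g(t) W(dt)`, a bounded continuous function on `ℝ^p`. Its means under the
laws of the blocks for `θ` and `θ₀` differ by `∫ |φ(·, θ) - φ(·, θ₀)|² dW`, which is positive by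
identification, because `W` charges every nonempty open set (`integral_chfTest_lt`). The average of
`f` over the simulated blocks at the estimator tends to the smaller mean
(`tendsto_average_chfTest`), whereas for parameters in a small neighbourhood of `θ` these averages
are eventually uniformly above a level strictly between the two means, by the strong law for the
infima of `f` over that neighbourhood (`exists_nhds_ae_eventually_lt_average`). So the estimator
eventually leaves a neighbourhood of `θ`, and compactness of `Θ` gives convergence to `θ₀`
(`ae_tendsto_of_ae_eventually_notMem`).
-/

/-! ### Birkhoff's pointwise ergodic theorem -/

section Ergodic

variable {α : Type*}

/-- The running maximum `max (0, S_1 g, …, S_N g)` of the Birkhoff sums of `g`, given by the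
recursion that drives the maximal ergodic argument. -/
def maxBirkhoffSum (T : α → α) (g : α → ℝ) : ℕ → α → ℝ
  | 0, _ => 0
  | N + 1, x => max 0 (g x + maxBirkhoffSum T g N (T x))

lemma maxBirkhoffSum_nonneg (T : α → α) (g : α → ℝ) (N : ℕ) (x : α) :
    0 ≤ maxBirkhoffSum T g N x := by
  cases N with
  | zero => exact le_rfl
  | succ N => exact le_max_left _ _

lemma maxBirkhoffSum_le_succ (T : α → α) (g : α → ℝ) (N : ℕ) (x : α) :
    maxBirkhoffSum T g N x ≤ maxBirkhoffSum T g (N + 1) x := by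
  induction N generalizing x with
  | zero => exact maxBirkhoffSum_nonneg T g _ x
  | succ N ih => exact max_le_max le_rfl (by linarith [ih (T x)])

lemma birkhoffSum_le_maxBirkhoffSum (T : α → α) (g : α → ℝ) (N : ℕ) (x : α) :
    birkhoffSum T g N x ≤ maxBirkhoffSum T g N x := by
  induction N generalizing x with
  | zero => simp [maxBirkhoffSum]
  | succ N ih =>
    rw [birkhoffSum_succ']
    exact le_max_of_le_right (by linarith [ih (T x)])

/-- The maxima of the Birkhoff sums are bounded along the orbit of `x` if and only if they are
along that of `T x`: the exceptional set of the ergodic theorem is invariant. -/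
lemma exists_maxBirkhoffSum_le_comp_iff (T : α → α) (g : α → ℝ) (x : α) :
    (∃ C : ℕ, ∀ N, maxBirkhoffSum T g N (T x) ≤ C) ↔
      ∃ C : ℕ, ∀ N, maxBirkhoffSum T g N x ≤ C := by
  constructor
  · rintro ⟨C, hC⟩
    obtain ⟨D, hD⟩ := exists_nat_ge (|g x| + C)
    refine ⟨D, fun N => (maxBirkhoffSum_le_succ T g N x).trans ?_⟩
    refine max_le (by positivity) ?_
    linarith [hC N, le_abs_self (g x)]
  · rintro ⟨C, hC⟩
    obtain ⟨D, hD⟩ := exists_nat_ge (|g x| + C)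
    refine ⟨D, fun N => ?_⟩
    have h := (le_max_right _ _).trans (hC (N + 1))
    linarith [neg_abs_le (g x)]

variable [MeasurableSpace α] {μ : Measure α}

lemma measurable_maxBirkhoffSum {T : α → α} {g : α → ℝ} (hT : Measurable T) (hg : Measurable g)
    (N : ℕ) : Measurable (maxBirkhoffSum T g N) := by
  induction N with
  | zero => exact measurable_const
  | succ N ih => exact measurable_const.max (hg.add (ih.comp hT))

lemma integrable_maxBirkhoffSum {T : α → α} {g : α → ℝ} (hT : MeasurePreserving T μ μ)
    (hg : Integrable g μ) (N : ℕ) : Integrable (maxBirkhoffSum T g N) μ := by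
  induction N with
  | zero => exact integrable_zero _ _ _
  | succ N ih =>
    exact (integrable_zero _ _ _).sup (hg.add (hT.integrable_comp_of_integrable ih))

/-- If `∫ g < 0`, the Birkhoff sums of `g` are almost everywhere bounded above. Otherwise the
maxima `M_N` tend to infinity almost everywhere by ergodicity, so that
`M_{N+1} - M_N ∘ T = max (-M_N ∘ T) g` tends to `g`; but its integral `∫ M_{N+1} - ∫ M_N` is
nonnegative. -/
lemma ae_exists_birkhoffSum_le [IsFiniteMeasure μ] {T : α → α} (hT : Ergodic T μ) {g : α → ℝ}
    (hgm : Measurable g) (hg : Integrable g μ) (hneg : ∫ x, g x ∂μ < 0) :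
    ∀ᵐ x ∂μ, ∃ C : ℝ, ∀ N, birkhoffSum T g N x ≤ C := by
  set M := maxBirkhoffSum T g
  have hTm := hT.toMeasurePreserving.measurable
  have hmeas : MeasurableSet {x | ∃ C : ℕ, ∀ N, M N x ≤ C} := by
    simp only [Set.ofPred_exists, Set.ofPred_forall]
    exact .iUnion fun C => .iInter fun N =>
      measurableSet_le (measurable_maxBirkhoffSum hTm hgm N) measurable_const
  have hinv : T ⁻¹' {x | ∃ C : ℕ, ∀ N, M N x ≤ C} = {x | ∃ C : ℕ, ∀ N, M N x ≤ C} :=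
    Set.ext fun x => exists_maxBirkhoffSum_le_comp_iff T g x
  rcases hT.toPreErgodic.ae_mem_or_ae_notMem hmeas hinv with h | h
  · filter_upwards [h] with x ⟨C, hC⟩
    exact ⟨C, fun N => (birkhoffSum_le_maxBirkhoffSum T g N x).trans (hC N)⟩
  · exfalso
    have hint := fun N => integrable_maxBirkhoffSum hT.toMeasurePreserving hg N
    have hintT := fun N => hT.toMeasurePreserving.integrable_comp_of_integrable (hint N)
    have hdiff : ∀ N x, M (N + 1) x - M N (T x) = max (-M N (T x)) (g x) := by
      intro N x
      change max 0 (g x + M N (T x)) - M N (T x) = _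
      rw [← max_sub_sub_right]
      simp
    have hlim : Tendsto (fun N => ∫ x, (M (N + 1) x - M N (T x)) ∂μ) atTop
        (𝓝 (∫ x, g x ∂μ)) := by
      refine tendsto_integral_of_dominated_convergence (fun x => |g x|) ?_ hg.abs ?_ ?_
      · exact fun N => ((hint (N + 1)).sub (hintT N)).aestronglyMeasurable
      · refine fun N => .of_forall fun x => ?_
        rw [hdiff, Real.norm_eq_abs, abs_le]
        refine ⟨(neg_abs_le _).trans (le_max_right _ _), max_le ?_ (le_abs_self _)⟩
        linarith [maxBirkhoffSum_nonneg T g N (T x), abs_nonneg (g x)]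
      · filter_upwards [h] with x hx
        have hx' : ¬ ∃ C : ℕ, ∀ N, M N (T x) ≤ C :=
          fun h => hx ((exists_maxBirkhoffSum_le_comp_iff T g x).1 h)
        push Not at hx'
        obtain ⟨D, hD⟩ := exists_nat_ge |g x|
        obtain ⟨N₀, hN₀⟩ := hx' D
        refine tendsto_const_nhds.congr' ?_
        filter_upwards [eventually_ge_atTop N₀] with N hN
        have hmono : M N₀ (T x) ≤ M N (T x) :=
          monotone_nat_of_le_succ (f := fun N => M N (T x))
            (fun N => maxBirkhoffSum_le_succ T g N (T x)) hN
        rw [hdiff, max_eq_right]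
        linarith [neg_abs_le (g x)]
    refine absurd (ge_of_tendsto' hlim fun N => ?_) (not_le.2 hneg)
    have hcomp : ∫ x, M N (T x) ∂μ = ∫ x, M N x ∂μ := by
      rw [← integral_map hTm.aemeasurable
        (by rw [hT.toMeasurePreserving.map_eq]; exact (hint N).aestronglyMeasurable),
        hT.toMeasurePreserving.map_eq]
    have hsub : ∫ x, (M (N + 1) x - M N (T x)) ∂μ = ∫ x, M (N + 1) x ∂μ - ∫ x, M N (T x) ∂μ :=
      integral_sub (hint (N + 1)) (hintT N)
    rw [hsub, hcomp, sub_nonneg]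
    exact integral_mono (hint N) (hint (N + 1)) fun x => maxBirkhoffSum_le_succ T g N x

lemma ae_birkhoffSum_le_add [IsProbabilityMeasure μ] {T : α → α} (hT : Ergodic T μ) {g : α → ℝ}
    (hgm : Measurable g) (hg : Integrable g μ) {ε : ℝ} (hε : 0 < ε) :
    ∀ᵐ x ∂μ, ∃ C : ℝ, ∀ N, birkhoffSum T g N x ≤ N * (∫ x, g x ∂μ + ε) + C := by
  set m := ∫ x, g x ∂μ
  have h := ae_exists_birkhoffSum_le hT (g := fun x => g x - (m + ε))
    (hgm.sub measurable_const) (hg.sub (integrable_const _)) (by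
      rw [integral_sub hg (integrable_const _)]
      simp [m, hε])
  filter_upwards [h] with x ⟨C, hC⟩
  refine ⟨C, fun N => ?_⟩
  have := hC N
  simp only [birkhoffSum, Finset.sum_sub_distrib, Finset.sum_const, Finset.card_range,
    nsmul_eq_mul] at this ⊢
  linarith

/-- **Birkhoff's pointwise ergodic theorem** for an ergodic map and a real function. -/
theorem ae_tendsto_birkhoffAverage [IsProbabilityMeasure μ] {T : α → α} (hT : Ergodic T μ)
    {g : α → ℝ} (hgm : Measurable g) (hg : Integrable g μ) :
    ∀ᵐ x ∂μ, Tendsto (fun N => birkhoffAverage ℝ T g N x) atTop (𝓝 (∫ x, g x ∂μ)) := by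
  have hupper : ∀ᵐ x ∂μ, ∀ k : ℕ, ∃ C : ℝ, ∀ N,
      birkhoffSum T g N x ≤ N * (∫ x, g x ∂μ + 1 / (k + 1)) + C :=
    ae_all_iff.2 fun k => ae_birkhoffSum_le_add hT hgm hg (by positivity)
  have hlower : ∀ᵐ x ∂μ, ∀ k : ℕ, ∃ C : ℝ, ∀ N,
      birkhoffSum T (-g) N x ≤ N * (∫ x, (-g) x ∂μ + 1 / (k + 1)) + C :=
    ae_all_iff.2 fun k => ae_birkhoffSum_le_add hT hgm.neg hg.neg (by positivity)
  filter_upwards [hupper, hlower] with x hu hl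
  rw [Metric.tendsto_atTop]
  intro ε hε
  obtain ⟨k, hk⟩ := exists_nat_one_div_lt (half_pos hε)
  obtain ⟨C, hC⟩ := hu k
  obtain ⟨D, hD⟩ := hl k
  obtain ⟨N₀, hN₀⟩ := exists_nat_gt ((|C| + |D|) / (ε / 2))
  refine ⟨N₀ + 1, fun N hN => ?_⟩
  have hNpos : (0 : ℝ) < N := by exact_mod_cast (by omega : 0 < N)
  have hlarge : |C| + |D| < N * (ε / 2) := by
    have : (N₀ : ℝ) ≤ N := by exact_mod_cast (by omega : N₀ ≤ N)
    rw [div_lt_iff₀ (half_pos hε)] at hN₀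
    nlinarith
  have hC := hC N
  have hD := hD N
  simp only [birkhoffSum_neg, Pi.neg_apply, integral_neg] at hD
  have hkN := mul_lt_mul_of_pos_left hk hNpos
  rw [Real.dist_eq, birkhoffAverage, smul_eq_mul, abs_lt, inv_mul_eq_div]
  constructor
  · rw [lt_sub_iff_add_lt, lt_div_iff₀ hNpos]
    nlinarith [le_abs_self D, abs_nonneg C]
  · rw [sub_lt_iff_lt_add, div_lt_iff₀ hNpos]
    nlinarith [le_abs_self C, abs_nonneg D]

end Ergodic

/-! ### A local uniform law of large numbers -/

section LocalUniformLaw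

variable {Ω S : Type*} [MeasurableSpace Ω] {P : Measure Ω} [IsProbabilityMeasure P]
  [TopologicalSpace S] [FirstCountableTopology S] [TopologicalSpace.SeparableSpace S]

/-- A one-sided uniform law of large numbers near a parameter. For bounded iid random functions
`Y_j` with continuous paths and a level `c` below the mean at `s₀`, the averages exceed `c`
uniformly on some neighbourhood of `s₀`, eventually almost surely: the strong law applies to the
infima of the `Y_j` over a small neighbourhood, whose mean is still above `c`. The infima are taken
over a countable dense set of parameters, which keeps them measurable. -/
theorem exists_nhds_ae_eventually_lt_average (Y : ℕ → S → Ω → ℝ)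
    (hmeas : ∀ j s, Measurable (Y j s))
    (hindep : iIndepFun (fun (j : ℕ) (ω : Ω) (s : S) => Y j s ω) P)
    (hident : ∀ j : ℕ, IdentDistrib (fun (ω : Ω) (s : S) => Y j s ω)
      (fun (ω : Ω) (s : S) => Y 0 s ω) P P)
    {C : ℝ} (hbdd : ∀ j s ω, |Y j s ω| ≤ C)
    (hcont : ∀ j, ∀ᵐ ω ∂P, Continuous fun s => Y j s ω)
    (s₀ : S) {c : ℝ} (hc : c < ∫ ω, Y 0 s₀ ω ∂P) :
    ∃ V ∈ 𝓝 s₀, ∀ᵐ ω ∂P, ∀ᶠ N : ℕ in atTop, ∀ s ∈ V,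
      c < (∑ j ∈ Finset.range N, Y j s ω) / N := by
  obtain ⟨D, hDc, hDd⟩ := TopologicalSpace.exists_countable_dense S
  obtain ⟨V, hV⟩ := (𝓝 s₀).exists_antitone_basis
  let I : ℕ → Set S := fun k => insert s₀ D ∩ interior (V k)
  have hIc : ∀ k, Countable (I k) := fun k => ((hDc.insert s₀).mono Set.inter_subset_left).to_subtype
  have hs₀ : ∀ k, s₀ ∈ I k := fun k =>
    ⟨Set.mem_insert _ _, mem_interior_iff_mem_nhds.2 (hV.1.mem_of_mem trivial)⟩
  have hIne : ∀ k, Nonempty (I k) := fun k => ⟨⟨s₀, hs₀ k⟩⟩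
  let h : ℕ → (S → ℝ) → ℝ := fun k y => ⨅ s : I k, y s
  have hhm : ∀ k, Measurable (h k) := fun k => .iInf fun s => measurable_pi_apply _
  have hbelow : ∀ k j ω, BddBelow (Set.range fun s : I k => Y j s ω) := fun k j ω =>
    ⟨-C, by rintro _ ⟨s, rfl⟩; exact (abs_le.1 (hbdd j s ω)).1⟩
  have hle : ∀ k j ω, ∀ s ∈ I k, h k (fun s => Y j s ω) ≤ Y j s ω := fun k j ω s hs =>
    ciInf_le (hbelow k j ω) ⟨s, hs⟩
  have hhb : ∀ k j ω, |h k (fun s => Y j s ω)| ≤ C := fun k j ω => by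
    refine abs_le.2 ⟨le_ciInf fun s => (abs_le.1 (hbdd j s ω)).1, ?_⟩
    exact (hle k j ω s₀ (hs₀ k)).trans (abs_le.1 (hbdd j s₀ ω)).2
  have hYm : ∀ j, Measurable fun ω s => Y j s ω := fun j => measurable_pi_lambda _ (hmeas j)
  have hlim : Tendsto (fun k => ∫ ω, h k (fun s => Y 0 s ω) ∂P) atTop (𝓝 (∫ ω, Y 0 s₀ ω ∂P)) := by
    refine tendsto_integral_of_dominated_convergence (fun _ => C)
      (fun k => ((hhm k).comp (hYm 0)).aestronglyMeasurable) (integrable_const _)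
      (fun k => .of_forall fun ω => hhb k 0 ω) ?_
    filter_upwards [hcont 0] with ω hω
    refine tendsto_order.2 ⟨fun a ha => ?_, fun a ha => .of_forall fun k =>
      (hle k 0 ω s₀ (hs₀ k)).trans_lt ha⟩
    obtain ⟨b, hab, hb⟩ := exists_between ha
    have hnhds : {s | b < Y 0 s ω} ∈ 𝓝 s₀ := hω.continuousAt.eventually_const_lt hb
    filter_upwards [hV.eventually_subset hnhds] with k hk
    exact hab.trans_le (le_ciInf fun s => (hk (interior_subset s.2.2)).le)
  obtain ⟨k, hk⟩ := (hlim.eventually_const_lt hc).exists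
  refine ⟨interior (V k), interior_mem_nhds.2 (hV.1.mem_of_mem trivial), ?_⟩
  have hslln := strong_law_ae_real (μ := P) (fun j ω => h k (fun s => Y j s ω))
    (Integrable.of_bound ((hhm k).comp (hYm 0)).aestronglyMeasurable C
      (.of_forall fun ω => hhb k 0 ω))
    (fun i j hij => (hindep.indepFun hij).comp (hhm k) (hhm k))
    (fun j => (hident j).comp (hhm k))
  filter_upwards [hslln, ae_all_iff.2 hcont] with ω hω hωc
  filter_upwards [hω.eventually_const_lt hk] with N hN s hs
  refine hN.trans_le (div_le_div_of_nonneg_right (Finset.sum_le_sum fun j _ => ?_) (by positivity))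
  have hclosure : s ∈ closure (I k) :=
    closure_mono (Set.inter_subset_inter_left _ (Set.subset_insert _ _))
      (by rw [Set.inter_comm]; exact hDd.open_subset_closure_inter isOpen_interior hs)
  exact closure_minimal (fun s hs => hle k j ω s hs)
    (isClosed_le continuous_const (hωc j)) hclosure

end LocalUniformLaw

/-! ### Convergence of empirical characteristic functions -/

section EmpiricalChf

variable {p : ℕ}

lemma norm_exp_inner_mul_I (t x : EuclideanSpace ℝ (Fin p)) :
    ‖Complex.exp ((inner ℝ t x : ℝ) * Complex.I)‖ = 1 :=
  Complex.norm_exp_ofReal_mul_I _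

lemma norm_empiricalChf_le (N : ℕ) (x : ℕ → EuclideanSpace ℝ (Fin p))
    (t : EuclideanSpace ℝ (Fin p)) : ‖empiricalChf N x t‖ ≤ 1 := by
  rw [empiricalChf, norm_mul, norm_div, norm_one, Complex.norm_natCast]
  have h : ‖∑ j ∈ Finset.range N, Complex.exp ((inner ℝ t (x j) : ℝ) * Complex.I)‖ ≤ N := by
    refine (norm_sum_le _ _).trans ?_
    simp
  rw [one_div_mul_eq_div]
  exact div_le_one_of_le₀ h (Nat.cast_nonneg _)

lemma continuous_empiricalChf (N : ℕ) (x : ℕ → EuclideanSpace ℝ (Fin p)) :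
    Continuous (empiricalChf N x) := by
  unfold empiricalChf
  fun_prop

lemma charFun_eq_integral_inner_left (ν : Measure (EuclideanSpace ℝ (Fin p)))
    (t : EuclideanSpace ℝ (Fin p)) :
    charFun ν t = ∫ x, Complex.exp ((inner ℝ t x : ℝ) * Complex.I) ∂ν := by
  simp_rw [charFun_apply, real_inner_comm]

variable {Ω : Type*} [MeasurableSpace Ω] {P : Measure Ω}

/-- If, for each fixed `t`, the empirical chf converges almost surely at `t`, then almost surely it
converges in `L²(W)` for a finite measure `W`: by Fubini, convergence holds almost surely at
`W`-almost every `t`, and everything is bounded. -/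
theorem ae_tendsto_integral_norm_empiricalChf_sub_sq [SFinite P]
    (W : Measure (EuclideanSpace ℝ (Fin p))) [IsFiniteMeasure W]
    (Y : ℕ → Ω → EuclideanSpace ℝ (Fin p)) (hY : ∀ j, Measurable (Y j))
    (ν : Measure (EuclideanSpace ℝ (Fin p))) [IsProbabilityMeasure ν]
    (h : ∀ t, ∀ᵐ ω ∂P, Tendsto (fun N => empiricalChf N (fun j => Y j ω) t) atTop
      (𝓝 (charFun ν t))) :
    ∀ᵐ ω ∂P, Tendsto (fun N => ∫ t, ‖empiricalChf N (fun j => Y j ω) t - charFun ν t‖ ^ 2 ∂W)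
      atTop (𝓝 0) := by
  have hchf : Measurable (charFun ν) := measurable_charFun
  have hmeas : MeasurableSet {z : EuclideanSpace ℝ (Fin p) × Ω |
      Tendsto (fun N => empiricalChf N (fun j => Y j z.2) z.1) atTop (𝓝 (charFun ν z.1))} := by
    refine measurableSet_tendsto_fun (fun N => ?_) (hchf.comp measurable_fst)
    unfold empiricalChf
    fun_prop
  have hae := (Measure.ae_ae_comm (μ := W) (ν := P) hmeas).1 (.of_forall h)
  filter_upwards [hae] with ω hω
  rw [← integral_zero (EuclideanSpace ℝ (Fin p)) ℝ (μ := W)]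
  refine tendsto_integral_of_dominated_convergence (fun _ => 2 ^ 2)
    (fun N => (by
      have := (continuous_empiricalChf N fun j => Y j ω).measurable
      exact ((this.sub hchf).norm.pow_const 2).aestronglyMeasurable)) (integrable_const _)
    (fun N => .of_forall fun t => ?_) ?_
  · rw [Real.norm_of_nonneg (by positivity)]
    gcongr
    refine (norm_sub_le _ _).trans ?_
    linarith [norm_empiricalChf_le N (fun j => Y j ω) t, norm_charFun_le_one (μ := ν) t]
  · filter_upwards [hω] with t ht
    simpa using ((ht.sub_const (charFun ν t)).norm.pow 2)

/-- The strong law of large numbers for the empirical chf of an iid sequence. -/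
lemma ae_tendsto_empiricalChf_of_iid [IsProbabilityMeasure P]
    (Y : ℕ → Ω → EuclideanSpace ℝ (Fin p)) (hY : ∀ j, Measurable (Y j))
    (hindep : iIndepFun Y P) (hident : ∀ j, IdentDistrib (Y j) (Y 0) P P)
    (t : EuclideanSpace ℝ (Fin p)) :
    ∀ᵐ ω ∂P, Tendsto (fun N => empiricalChf N (fun j => Y j ω) t) atTop
      (𝓝 (charFun (P.map (Y 0)) t)) := by
  have hK : Measurable fun x : EuclideanSpace ℝ (Fin p) =>
      Complex.exp ((inner ℝ t x : ℝ) * Complex.I) := by fun_prop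
  have h := strong_law_ae (μ := P)
    (fun j ω => Complex.exp ((inner ℝ t (Y j ω) : ℝ) * Complex.I))
    (Integrable.of_bound (hK.comp (hY 0)).aestronglyMeasurable 1
      (.of_forall fun ω => (norm_exp_inner_mul_I _ _).le))
    (fun i j hij => (hindep.indepFun hij).comp hK hK) (fun j => (hident j).comp hK)
  rw [charFun_eq_integral_inner_left, integral_map (hY 0).aemeasurable hK.aestronglyMeasurable]
  filter_upwards [h] with ω hω
  refine hω.congr fun N => ?_
  simp [empiricalChf, Complex.real_smul]

lemma measurable_seriesBlock {X : ℤ → Ω → ℝ} (hX : ∀ j, Measurable (X j)) (j : ℤ) :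
    Measurable (seriesBlock p X j) :=
  (WithLp.measurable_toLp 2 _).comp (measurable_pi_lambda _ fun _ => hX _)

lemma seqShift_iterate (n : ℕ) (x : ℤ → ℝ) (k : ℤ) : seqShift^[n] x k = x (k + n) := by
  induction n generalizing x with
  | zero => simp
  | succ n ih =>
    rw [Function.iterate_succ_apply, ih, seqShift]
    push_cast
    congr 1
    ring

/-- The time averages of a bounded measurable function of the blocks of a stationary ergodic series
converge almost surely to its mean. -/
lemma ae_tendsto_average_seriesBlock [IsProbabilityMeasure P] {X : ℤ → Ω → ℝ}
    (hX : ∀ j, Measurable (X j)) (herg : IsStationaryErgodicSeries P X)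
    {f : EuclideanSpace ℝ (Fin p) → ℝ} (hf : Measurable f) {C : ℝ} (hC : ∀ x, |f x| ≤ C) :
    ∀ᵐ ω ∂P, Tendsto
      (fun N : ℕ => (N : ℝ)⁻¹ * ∑ j ∈ Finset.range N, f (seriesBlock p X ((j : ℤ) + 1) ω))
      atTop (𝓝 (∫ x, f x ∂(P.map (seriesBlock p X 1)))) := by
  have hXm : Measurable fun ω j => X j ω := measurable_pi_lambda _ hX
  have : IsProbabilityMeasure (seriesLaw P X) := Measure.isProbabilityMeasure_map hXm.aemeasurable
  -- the coordinate process on the sequence space, of which `X` is an image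
  have hcoord := measurable_seriesBlock (p := p) (X := fun (j : ℤ) (x : ℤ → ℝ) => x j)
    (fun j => measurable_pi_apply j) 1
  have h := ae_tendsto_birkhoffAverage herg (hf.comp hcoord)
    (Integrable.of_bound (hf.comp hcoord).aestronglyMeasurable C (.of_forall fun x => hC _))
  have hint : ∫ x, (f ∘ seriesBlock p (fun j x => x j) 1) x ∂(seriesLaw P X) =
      ∫ x, f x ∂(P.map (seriesBlock p X 1)) := by
    rw [seriesLaw, integral_map hXm.aemeasurable (hf.comp hcoord).aestronglyMeasurable,
      integral_map (measurable_seriesBlock hX 1).aemeasurable hf.aestronglyMeasurable]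
    rfl
  rw [hint] at h
  filter_upwards [ae_of_ae_map hXm.aemeasurable h] with ω hω
  refine hω.congr fun N => ?_
  rw [birkhoffAverage, birkhoffSum, smul_eq_mul]
  congr 1
  refine Finset.sum_congr rfl fun j _ => ?_
  simp only [Function.comp_apply, seriesBlock, seqShift_iterate]
  congr 2
  ext k
  congr 1
  ring

/-- Pointwise almost sure convergence of the empirical chf of the blocks of a stationary ergodic
series. -/
lemma ae_tendsto_empiricalChf_seriesBlock [IsProbabilityMeasure P] {X : ℤ → Ω → ℝ}
    (hX : ∀ j, Measurable (X j)) (herg : IsStationaryErgodicSeries P X)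
    (t : EuclideanSpace ℝ (Fin p)) :
    ∀ᵐ ω ∂P, Tendsto
      (fun N => empiricalChf N (fun j => seriesBlock p X ((j : ℤ) + 1) ω) t) atTop
      (𝓝 (charFun (P.map (seriesBlock p X 1)) t)) := by
  have hK : Measurable fun x : EuclideanSpace ℝ (Fin p) =>
      Complex.exp ((inner ℝ t x : ℝ) * Complex.I) := by fun_prop
  have : IsProbabilityMeasure (P.map (seriesBlock p X 1)) :=
    Measure.isProbabilityMeasure_map (measurable_seriesBlock hX 1).aemeasurable
  have hKint : Integrable (fun x => Complex.exp ((inner ℝ t x : ℝ) * Complex.I))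
      (P.map (seriesBlock p X 1)) :=
    Integrable.of_bound hK.aestronglyMeasurable 1
      (.of_forall fun x => (norm_exp_inner_mul_I _ _).le)
  have hre := ae_tendsto_average_seriesBlock hX herg (Complex.measurable_re.comp hK) (C := 1)
    fun x => (Complex.abs_re_le_norm _).trans (norm_exp_inner_mul_I _ _).le
  have him := ae_tendsto_average_seriesBlock hX herg (Complex.measurable_im.comp hK) (C := 1)
    fun x => (Complex.abs_im_le_norm _).trans (norm_exp_inner_mul_I _ _).le
  filter_upwards [hre, him] with ω hr hi
  rw [charFun_eq_integral_inner_left, ← integral_re_add_im hKint]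
  have hr' := (Complex.continuous_ofReal.tendsto _).comp hr
  have hi' := (Complex.continuous_ofReal.tendsto _).comp hi
  refine (hr'.add (hi'.mul_const Complex.I)).congr fun N => ?_
  simp only [Function.comp_apply, Complex.ofReal_mul, Complex.ofReal_inv, Complex.ofReal_natCast,
    Complex.ofReal_sum, empiricalChf, one_div]
  rw [mul_assoc, ← mul_add, Finset.sum_mul, ← Finset.sum_add_distrib]
  congr 1
  exact Finset.sum_congr rfl fun j _ => Complex.re_add_im _

end EmpiricalChf

/-! ### Test functions separating characteristic functions -/

section TestFunction

variable {p : ℕ}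

/-- The function `x ↦ Re ∫ exp(i⟨t, x⟩) g(t) W(dt)`. Its averages over a sample are the pairings of
`g` with the empirical chf, and its mean is the pairing of `g` with the chf. -/
noncomputable def chfTest (W : Measure (EuclideanSpace ℝ (Fin p))) (g : EuclideanSpace ℝ (Fin p) → ℂ)
    (x : EuclideanSpace ℝ (Fin p)) : ℝ :=
  (∫ t, Complex.exp ((inner ℝ t x : ℝ) * Complex.I) * g t ∂W).re

variable {W : Measure (EuclideanSpace ℝ (Fin p))} [IsFiniteMeasure W]
  {g : EuclideanSpace ℝ (Fin p) → ℂ}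

lemma integrable_mul_of_bounded {φ : EuclideanSpace ℝ (Fin p) → ℂ} (hφ : Continuous φ)
    (hg : Continuous g) {C D : ℝ} (hφD : ∀ t, ‖φ t‖ ≤ D) (hgC : ∀ t, ‖g t‖ ≤ C) :
    Integrable (fun t => φ t * g t) W :=
  Integrable.of_bound (hφ.mul hg).aestronglyMeasurable (D * C) (.of_forall fun t => by
    rw [norm_mul]
    exact mul_le_mul (hφD t) (hgC t) (norm_nonneg _) ((norm_nonneg _).trans (hφD t)))

lemma abs_chfTest_le {C : ℝ} (hgC : ∀ t, ‖g t‖ ≤ C) (x : EuclideanSpace ℝ (Fin p)) :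
    |chfTest W g x| ≤ C * W.real Set.univ := by
  refine (Complex.abs_re_le_norm _).trans (norm_integral_le_of_norm_le_const (.of_forall fun t => ?_))
  rw [norm_mul, norm_exp_inner_mul_I, one_mul]
  exact hgC t

lemma continuous_chfTest (hg : Continuous g) {C : ℝ} (hgC : ∀ t, ‖g t‖ ≤ C) :
    Continuous (chfTest W g) := by
  refine Complex.continuous_re.comp (continuous_of_dominated (bound := fun _ => C)
    (fun x => ?_) (fun x => .of_forall fun t => ?_) (integrable_const _) (.of_forall fun t => ?_))
  · exact Continuous.aestronglyMeasurable (by fun_prop)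
  · rw [norm_mul, norm_exp_inner_mul_I, one_mul]
    exact hgC t
  · fun_prop

lemma average_chfTest (hg : Continuous g) {C : ℝ} (hgC : ∀ t, ‖g t‖ ≤ C) (N : ℕ)
    (x : ℕ → EuclideanSpace ℝ (Fin p)) :
    (∑ j ∈ Finset.range N, chfTest W g (x j)) / N = (∫ t, empiricalChf N x t * g t ∂W).re := by
  have hint : ∀ j ∈ Finset.range N,
      Integrable (fun t => Complex.exp ((inner ℝ t (x j) : ℝ) * Complex.I) * g t) W := fun j _ =>
    integrable_mul_of_bounded (by fun_prop) hg (fun t => (norm_exp_inner_mul_I t _).le) hgC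
  simp_rw [empiricalChf, mul_assoc, Finset.sum_mul]
  rw [integral_const_mul, integral_finsetSum _ hint]
  simp only [chfTest, ← Complex.re_sum]
  rw [one_div_mul_eq_div, Complex.div_natCast_re]

lemma integral_chfTest (hg : Continuous g) {C : ℝ} (hgC : ∀ t, ‖g t‖ ≤ C)
    (ν : Measure (EuclideanSpace ℝ (Fin p))) [IsFiniteMeasure ν] :
    ∫ x, chfTest W g x ∂ν = (∫ t, charFun ν t * g t ∂W).re := by
  have hint : Integrable (fun z : EuclideanSpace ℝ (Fin p) × EuclideanSpace ℝ (Fin p) =>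
      Complex.exp ((inner ℝ z.2 z.1 : ℝ) * Complex.I) * g z.2) (ν.prod W) :=
    Integrable.of_bound (Continuous.aestronglyMeasurable (by fun_prop)) C (.of_forall fun z => by
      rw [norm_mul, norm_exp_inner_mul_I, one_mul]
      exact hgC _)
  have hre := integral_re (𝕜 := ℂ) hint.integral_prod_left
  simp only [RCLike.re_to_complex] at hre
  simp only [chfTest]
  rw [hre, integral_integral_swap hint]
  simp_rw [charFun_eq_integral_inner_left, integral_mul_const]

/-- Pairing with a bounded function is controlled by the `L¹(W)` distance. -/
lemma abs_re_integral_mul_sub_le (hg : Continuous g) {C : ℝ} (hgC : ∀ t, ‖g t‖ ≤ C)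
    {φ ψ : EuclideanSpace ℝ (Fin p) → ℂ} (hφ : Continuous φ) (hψ : Continuous ψ)
    (hφ1 : ∀ t, ‖φ t‖ ≤ 1) (hψ1 : ∀ t, ‖ψ t‖ ≤ 1) :
    |(∫ t, φ t * g t ∂W).re - (∫ t, ψ t * g t ∂W).re| ≤ C * ∫ t, ‖φ t - ψ t‖ ∂W := by
  rw [← Complex.sub_re, ← integral_sub (integrable_mul_of_bounded hφ hg hφ1 hgC)
    (integrable_mul_of_bounded hψ hg hψ1 hgC)]
  refine (Complex.abs_re_le_norm _).trans ?_
  rw [← integral_const_mul]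
  have hd : Integrable (fun t => φ t - ψ t) W :=
    Integrable.of_bound (hφ.sub hψ).aestronglyMeasurable 2 (.of_forall fun t => by
      linarith [norm_sub_le (φ t) (ψ t), hφ1 t, hψ1 t])
  refine norm_integral_le_of_norm_le (hd.norm.const_mul C) (.of_forall fun t => ?_)
  rw [← sub_mul, norm_mul, mul_comm]
  exact mul_le_mul_of_nonneg_right (hgC t) (norm_nonneg _)

lemma sq_integral_le_mul_integral_sq {h : EuclideanSpace ℝ (Fin p) → ℝ} (hh : Integrable h W)
    (hh2 : Integrable (fun t => h t ^ 2) W) :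
    (∫ t, h t ∂W) ^ 2 ≤ W.real Set.univ * ∫ t, h t ^ 2 ∂W := by
  have hq : ∀ c : ℝ, 0 ≤ W.real Set.univ * (c * c) + (-2 * ∫ t, h t ∂W) * c
      + ∫ t, h t ^ 2 ∂W := fun c => by
    have h0 : 0 ≤ ∫ t, (h t - c) ^ 2 ∂W := integral_nonneg fun t => sq_nonneg _
    have h1 : ∀ t, (h t - c) ^ 2 = h t ^ 2 + (-(2 * c) * h t + c * c) := fun t => by ring
    simp_rw [h1] at h0
    have hlin : Integrable (fun t => -(2 * c) * h t + c * c) W :=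
      (hh.const_mul _).add (integrable_const _)
    rw [integral_add hh2 hlin, integral_add (hh.const_mul _) (integrable_const _),
      integral_const_mul, integral_const, smul_eq_mul] at h0
    linarith
  have := discrim_le_zero hq
  rw [discrim] at this
  nlinarith

/-- Convergence in `L²(W)` implies convergence in `L¹(W)`, for bounded functions. -/
lemma tendsto_integral_norm_sub_of_sq {φ ψ : ℕ → EuclideanSpace ℝ (Fin p) → ℂ}
    (hφ : ∀ n, Continuous (φ n)) (hψ : ∀ n, Continuous (ψ n))
    (hφ1 : ∀ n t, ‖φ n t‖ ≤ 1) (hψ1 : ∀ n t, ‖ψ n t‖ ≤ 1)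
    (h : Tendsto (fun n => ∫ t, ‖φ n t - ψ n t‖ ^ 2 ∂W) atTop (𝓝 0)) :
    Tendsto (fun n => ∫ t, ‖φ n t - ψ n t‖ ∂W) atTop (𝓝 0) := by
  have hb : ∀ n t, ‖φ n t - ψ n t‖ ≤ 2 := fun n t => by
    linarith [norm_sub_le (φ n t) (ψ n t), hφ1 n t, hψ1 n t]
  have hc : ∀ n, Continuous fun t => ‖φ n t - ψ n t‖ := fun n => ((hφ n).sub (hψ n)).norm
  have hsqrt := (h.const_mul (W.real Set.univ)).sqrt
  rw [mul_zero, Real.sqrt_zero] at hsqrt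
  refine squeeze_zero (fun n => integral_nonneg fun t => norm_nonneg _) (fun n => ?_) hsqrt
  refine Real.le_sqrt_of_sq_le (sq_integral_le_mul_integral_sq ?_ ?_)
  · exact Integrable.of_bound (hc n).aestronglyMeasurable 2 (.of_forall fun t => by
      rw [norm_norm]; exact hb n t)
  · exact Integrable.of_bound ((hc n).pow 2).aestronglyMeasurable (2 ^ 2) (.of_forall fun t => by
      rw [norm_pow, norm_norm]
      exact pow_le_pow_left₀ (norm_nonneg _) (hb n t) 2)

/-- Testing the difference of two chfs against its own conjugate separates the two laws as soon as
the chfs differ at one point, if `W` charges every nonempty open set. -/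
lemma integral_chfTest_lt [W.IsOpenPosMeasure] (ν₀ ν : Measure (EuclideanSpace ℝ (Fin p)))
    [IsProbabilityMeasure ν₀] [IsProbabilityMeasure ν] {s : EuclideanSpace ℝ (Fin p)}
    (hs : charFun ν s ≠ charFun ν₀ s) :
    ∫ x, chfTest W (fun t => (starRingEnd ℂ) (charFun ν t - charFun ν₀ t)) x ∂ν₀ <
      ∫ x, chfTest W (fun t => (starRingEnd ℂ) (charFun ν t - charFun ν₀ t)) x ∂ν := by
  have hd : Continuous fun t => charFun ν t - charFun ν₀ t :=
    continuous_charFun.sub continuous_charFun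
  have hg : Continuous fun t => (starRingEnd ℂ) (charFun ν t - charFun ν₀ t) :=
    Complex.continuous_conj.comp hd
  have hb : ∀ t, ‖charFun ν t - charFun ν₀ t‖ ≤ 2 := fun t => by
    linarith [norm_sub_le (charFun ν t) (charFun ν₀ t), norm_charFun_le_one (μ := ν) t,
      norm_charFun_le_one (μ := ν₀) t]
  have hgC : ∀ t, ‖(starRingEnd ℂ) (charFun ν t - charFun ν₀ t)‖ ≤ 2 := fun t => by
    rw [RCLike.norm_conj]; exact hb t
  rw [integral_chfTest hg hgC, integral_chfTest hg hgC, ← sub_pos, ← Complex.sub_re,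
    ← integral_sub
      (integrable_mul_of_bounded continuous_charFun hg (fun t => norm_charFun_le_one t) hgC)
      (integrable_mul_of_bounded continuous_charFun hg (fun t => norm_charFun_le_one t) hgC)]
  simp_rw [← sub_mul, Complex.mul_conj, integral_complex_ofReal, Complex.ofReal_re,
    Complex.normSq_eq_norm_sq]
  refine integral_pos_of_integrable_nonneg_nonzero (x := s) (hd.norm.pow 2) ?_
    (fun t => by positivity) (by simpa [sub_eq_zero] using hs)
  exact Integrable.of_bound (hd.norm.pow 2).aestronglyMeasurable (2 ^ 2) (.of_forall fun t => by
    rw [norm_pow, norm_norm]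
    exact pow_le_pow_left₀ (norm_nonneg _) (hb t) 2)

end TestFunction

/-! ### The weighted criterion and consistency -/

section WeightMeasure

variable {p : ℕ} {w : EuclideanSpace ℝ (Fin p) → ℝ}

/-- The measure `w(t) dt` on `ℝ^p`. -/
noncomputable def weightMeasure (w : EuclideanSpace ℝ (Fin p) → ℝ) :
    Measure (EuclideanSpace ℝ (Fin p)) :=
  volume.withDensity fun t => ENNReal.ofReal (w t)

lemma isFiniteMeasure_weightMeasure (hwint : Integrable w) :
    IsFiniteMeasure (weightMeasure w) :=
  isFiniteMeasure_withDensity_ofReal hwint.2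

lemma isOpenPosMeasure_weightMeasure (hwnonneg : ∀ t, 0 ≤ w t) (hwint : Integrable w)
    (hwsupp : ∀ U : Set (EuclideanSpace ℝ (Fin p)), IsOpen U → U.Nonempty → 0 < ∫ t in U, w t) :
    (weightMeasure w).IsOpenPosMeasure where
  open_pos U hU hne := by
    rw [weightMeasure, withDensity_apply _ hU.measurableSet,
      ← ofReal_integral_eq_lintegral_ofReal hwint.integrableOn (.of_forall hwnonneg)]
    exact (ENNReal.ofReal_pos.2 (hwsupp U hU hne)).ne'

lemma integral_weightMeasure (hwnonneg : ∀ t, 0 ≤ w t) (hwint : Integrable w)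
    (h : EuclideanSpace ℝ (Fin p) → ℝ) :
    ∫ t, h t ∂(weightMeasure w) = ∫ t, h t * w t := by
  rw [weightMeasure, integral_withDensity_eq_integral_toReal_smul₀
    hwint.aestronglyMeasurable.aemeasurable.ennreal_ofReal (.of_forall fun _ => ENNReal.ofReal_lt_top)]
  simp [ENNReal.toReal_ofReal (hwnonneg _), mul_comm]

end WeightMeasure

section Consistency

lemma ae_tendsto_of_ae_eventually_notMem {Ω S : Type*} [MeasurableSpace Ω] {P : Measure Ω}
    [MetricSpace S] [CompactSpace S] (u : ℕ → Ω → S) (s₀ : S)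
    (h : ∀ s ≠ s₀, ∃ V ∈ 𝓝 s, ∀ᵐ ω ∂P, ∀ᶠ n in atTop, u n ω ∉ V) :
    ∀ᵐ ω ∂P, Tendsto (fun n => u n ω) atTop (𝓝 s₀) := by
  have hk : ∀ k : ℕ, ∀ᵐ ω ∂P, ∀ᶠ n in atTop, dist (u n ω) s₀ < 1 / (k + 1) := fun k => by
    have hclosed : IsClosed {s | 1 / ((k : ℝ) + 1) ≤ dist s s₀} :=
      isClosed_le continuous_const (continuous_id.dist continuous_const)
    have hne : ∀ s ∈ {s | 1 / ((k : ℝ) + 1) ≤ dist s s₀}, s ≠ s₀ := fun s hs =>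
      dist_pos.1 (lt_of_lt_of_le (by positivity) hs)
    choose! V hV hVae using h
    obtain ⟨F, hF, hcover⟩ := hclosed.isCompact.elim_nhds_subcover V fun s hs => hV s (hne s hs)
    have hall : ∀ᵐ ω ∂P, ∀ s ∈ F, ∀ᶠ n in atTop, u n ω ∉ V s :=
      (ae_ball_iff F.countable_toSet).2 fun s hs => hVae s (hne s (hF s hs))
    filter_upwards [hall] with ω hω
    filter_upwards [(Filter.eventually_all_finset F).2 hω] with n hn
    by_contra! hcon
    obtain ⟨s, hs, hmem⟩ := Set.mem_iUnion₂.1 (hcover hcon)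
    exact hn s hs hmem
  filter_upwards [ae_all_iff.2 hk] with ω hω
  refine Metric.tendsto_nhds.2 fun ε hε => ?_
  obtain ⟨k, hkε⟩ := exists_nat_one_div_lt hε
  exact (hω k).mono fun n hn => hn.trans hkε

variable {p : ℕ}

lemma integral_norm_sub_sq_le_two_mul {W : Measure (EuclideanSpace ℝ (Fin p))} [IsFiniteMeasure W]
    {φ ψ χ : EuclideanSpace ℝ (Fin p) → ℂ} (hφ : Continuous φ) (hψ : Continuous ψ)
    (hχ : Continuous χ) (hφ1 : ∀ t, ‖φ t‖ ≤ 1) (hψ1 : ∀ t, ‖ψ t‖ ≤ 1) (hχ1 : ∀ t, ‖χ t‖ ≤ 1) :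
    ∫ t, ‖φ t - ψ t‖ ^ 2 ∂W ≤
      2 * (∫ t, ‖φ t - χ t‖ ^ 2 ∂W) + 2 * ∫ t, ‖ψ t - χ t‖ ^ 2 ∂W := by
  have hint : ∀ {f g : EuclideanSpace ℝ (Fin p) → ℂ}, Continuous f → Continuous g →
      (∀ t, ‖f t‖ ≤ 1) → (∀ t, ‖g t‖ ≤ 1) → Integrable (fun t => ‖f t - g t‖ ^ 2) W :=
    fun {f g} hf hg hf1 hg1 => Integrable.of_bound
      ((hf.sub hg).norm.pow 2).aestronglyMeasurable (2 ^ 2) (.of_forall fun t => by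
        rw [norm_pow, norm_norm]
        refine pow_le_pow_left₀ (norm_nonneg _) ?_ 2
        linarith [norm_sub_le (f t) (g t), hf1 t, hg1 t])
  have h1 := (hint hφ hχ hφ1 hχ1).const_mul 2
  have h2 := (hint hψ hχ hψ1 hχ1).const_mul 2
  rw [← integral_const_mul, ← integral_const_mul, ← integral_add h1 h2]
  refine integral_mono (hint hφ hψ hφ1 hψ1) (h1.add h2) fun t => ?_
  have htri : ‖φ t - ψ t‖ ≤ ‖φ t - χ t‖ + ‖ψ t - χ t‖ := by
    rw [norm_sub_rev (ψ t)]
    exact norm_sub_le_norm_sub_add_norm_sub _ _ _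
  change ‖φ t - ψ t‖ ^ 2 ≤ 2 * ‖φ t - χ t‖ ^ 2 + 2 * ‖ψ t - χ t‖ ^ 2
  nlinarith [norm_nonneg (φ t - ψ t), sq_nonneg (‖φ t - χ t‖ - ‖ψ t - χ t‖)]

/-- If the observed empirical chfs `φ_n` tend to the chf of `ν₀` in `L²(W)` and the criterion at
`s_n` tends to `0`, then the average over the simulated sample at `s_n` of any `chfTest` function
tends to its mean under `ν₀`. -/
lemma tendsto_average_chfTest {W : Measure (EuclideanSpace ℝ (Fin p))} [IsFiniteMeasure W]
    (ν₀ : Measure (EuclideanSpace ℝ (Fin p))) [IsProbabilityMeasure ν₀]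
    {g : EuclideanSpace ℝ (Fin p) → ℂ} (hg : Continuous g) {C : ℝ} (hgC : ∀ t, ‖g t‖ ≤ C)
    {φ : ℕ → EuclideanSpace ℝ (Fin p) → ℂ} (hφ : ∀ n, Continuous (φ n))
    (hφ1 : ∀ n t, ‖φ n t‖ ≤ 1) (N : ℕ → ℕ) (y : ℕ → ℕ → EuclideanSpace ℝ (Fin p))
    (hobs : Tendsto (fun n => ∫ t, ‖φ n t - charFun ν₀ t‖ ^ 2 ∂W) atTop (𝓝 0))
    (hcrit : Tendsto (fun n => ∫ t, ‖φ n t - empiricalChf (N n) (y n) t‖ ^ 2 ∂W) atTop (𝓝 0)) :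
    Tendsto (fun n => (∑ j ∈ Finset.range (N n), chfTest W g (y n j)) / N n) atTop
      (𝓝 (∫ x, chfTest W g x ∂ν₀)) := by
  have hE := fun n => continuous_empiricalChf (N n) (y n)
  have hE1 := fun n => norm_empiricalChf_le (N n) (y n)
  have hchf1 : ∀ t, ‖charFun ν₀ t‖ ≤ 1 := fun t => norm_charFun_le_one t
  have hsq : Tendsto (fun n => ∫ t, ‖empiricalChf (N n) (y n) t - charFun ν₀ t‖ ^ 2 ∂W) atTop
      (𝓝 0) := by
    have hsum := (hcrit.const_mul 2).add (hobs.const_mul 2)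
    rw [mul_zero, add_zero] at hsum
    refine squeeze_zero (fun n => integral_nonneg fun t => by positivity) (fun n => ?_) hsum
    have := integral_norm_sub_sq_le_two_mul (W := W) (hE n) continuous_charFun (hφ n)
      (hE1 n) hchf1 (hφ1 n)
    simp_rw [norm_sub_rev (φ n _)]
    exact this
  have hL1 := tendsto_integral_norm_sub_of_sq hE (fun _ => continuous_charFun) hE1
    (fun _ => hchf1) hsq
  refine tendsto_iff_dist_tendsto_zero.2 (squeeze_zero (fun n => dist_nonneg) (fun n => ?_)
    (by simpa using hL1.const_mul C))
  rw [average_chfTest hg hgC, integral_chfTest hg hgC, Real.dist_eq]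
  exact abs_re_integral_mul_sub_le hg hgC (hE n) continuous_charFun (hE1 n) hchf1

end Consistency

theorem theorem3p1 {p q : ℕ} {Ω : Type*} [MeasurableSpace Ω]
    (P : Measure Ω) [IsProbabilityMeasure P]
    -- the compact parameter set, with the true parameter in its interior
    (Θ : Set (EuclideanSpace ℝ (Fin q))) (hΘ : IsCompact Θ)
    (θ₀ : Θ) (hθ₀ : (θ₀ : EuclideanSpace ℝ (Fin q)) ∈ interior Θ)
    -- the model: a stationary series `(X_j(θ))_{j ∈ ℤ}` for every `θ`
    (X : Θ → ℤ → Ω → ℝ) (hXmeas : ∀ θ j, Measurable (X θ j))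
    (hXstat : ∀ θ, IsStationarySeries P (X θ))
    -- the observed series `X_j = X_j(θ₀)` is stationary and ergodic
    (hXerg : IsStationaryErgodicSeries P (X θ₀))
    -- the parameter is identified by the chf of the blocks of length `p`
    (hident : ∀ θ : Θ, (∀ t, modelChf P p X t θ = modelChf P p X t θ₀) → θ = θ₀)
    -- the simulated blocks: iid random functions of `θ`, independent of the observed series,
    -- with the marginal distributions of the model, and with continuous paths
    (Xsim : ℕ → Θ → Ω → EuclideanSpace ℝ (Fin p))
    (hsimmeas : ∀ j θ, Measurable (Xsim j θ))
    (hsimindep : iIndepFun (fun (j : ℕ) (ω : Ω) (θ : Θ) => Xsim j θ ω) P)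
    (hsimident : ∀ j : ℕ, IdentDistrib (fun (ω : Ω) (θ : Θ) => Xsim j θ ω)
      (fun (ω : Ω) (θ : Θ) => Xsim 0 θ ω) P P)
    (hsimobs : IndepFun (fun (ω : Ω) (j : ℤ) => X θ₀ j ω)
      (fun (ω : Ω) (j : ℕ) (θ : Θ) => Xsim j θ ω) P)
    (hsimlaw : ∀ j θ, IdentDistrib (Xsim j θ) (seriesBlock p (X θ) 1) P P)
    (hsimcont : ∀ j, ∀ᵐ ω ∂P, Continuous (fun θ : Θ => Xsim j θ ω))
    -- the weight function: nonnegative, integrable, and not vanishing almost everywhere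
    -- on any nonempty open set
    (w : EuclideanSpace ℝ (Fin p) → ℝ) (hwnonneg : ∀ t, 0 ≤ w t) (hwint : Integrable w)
    (hwsupp : ∀ U : Set (EuclideanSpace ℝ (Fin p)), IsOpen U → U.Nonempty → 0 < ∫ t in U, w t)
    -- the simulation sizes
    (H : ℕ → ℕ) (hH : Tendsto H atTop atTop)
    -- the estimator: any minimizer over `Θ` of the criterion
    (θhat : ℕ → Ω → Θ)
    (hθhat : ∀ᵐ ω ∂P, ∀ n ≥ 1, ∀ θ : Θ,
      simCriterion w (X θ₀) Xsim n (H n) ω (θhat n ω) ≤ simCriterion w (X θ₀) Xsim n (H n) ω θ) :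
    ∀ᵐ ω ∂P, Tendsto (fun n => (θhat n ω : EuclideanSpace ℝ (Fin q))) atTop
      (𝓝 (θ₀ : EuclideanSpace ℝ (Fin q))) := by
  set W := weightMeasure w
  have hWfin : IsFiniteMeasure W := isFiniteMeasure_weightMeasure hwint
  have hWpos : W.IsOpenPosMeasure := isOpenPosMeasure_weightMeasure hwnonneg hwint hwsupp
  have hcriterion : ∀ n N ω θ, simCriterion w (X θ₀) Xsim n N ω θ =
      ∫ t, ‖empiricalChf n (fun j => seriesBlock p (X θ₀) ((j : ℤ) + 1) ω) t
        - empiricalChf N (fun j => Xsim j θ ω) t‖ ^ 2 ∂W :=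
    fun n N ω θ => (integral_weightMeasure hwnonneg hwint _).symm
  have : CompactSpace Θ := isCompact_iff_compactSpace.1 hΘ
  set ν : Θ → Measure (EuclideanSpace ℝ (Fin p)) := fun θ => P.map (seriesBlock p (X θ) 1)
  have hνprob : ∀ θ, IsProbabilityMeasure (ν θ) := fun θ =>
    Measure.isProbabilityMeasure_map (measurable_seriesBlock (hXmeas θ) 1).aemeasurable
  have hsimmap : ∀ j θ, P.map (Xsim j θ) = ν θ := fun j θ => (hsimlaw j θ).map_eq
  -- both empirical chfs at the true parameter converge to its chf in `L²(W)`
  have hobs := ae_tendsto_integral_norm_empiricalChf_sub_sq W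
    (fun j => seriesBlock p (X θ₀) ((j : ℤ) + 1))
    (fun j => measurable_seriesBlock (hXmeas θ₀) _) (ν θ₀)
    (ae_tendsto_empiricalChf_seriesBlock (hXmeas θ₀) hXerg)
  have hsim := ae_tendsto_integral_norm_empiricalChf_sub_sq W (fun j => Xsim j θ₀)
    (fun j => hsimmeas j θ₀) (ν θ₀) (P := P) (fun t => by
      rw [← hsimmap 0 θ₀]
      exact ae_tendsto_empiricalChf_of_iid _ (fun j => hsimmeas j θ₀)
        (hsimindep.comp (fun _ x => x θ₀) fun _ => measurable_pi_apply θ₀)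
        (fun j => (hsimident j).comp (measurable_pi_apply θ₀)) t)
  -- hence the minimum of the criterion tends to `0`
  have hmin : ∀ᵐ ω ∂P, Tendsto
      (fun n => simCriterion w (X θ₀) Xsim n (H n) ω (θhat n ω)) atTop (𝓝 0) := by
    filter_upwards [hobs, hsim, hθhat] with ω hω₁ hω₂ hω₃
    have hsum := (hω₁.const_mul 2).add ((hω₂.comp hH).const_mul 2)
    rw [mul_zero, add_zero] at hsum
    refine tendsto_of_tendsto_of_tendsto_of_le_of_le' tendsto_const_nhds hsum
      (.of_forall fun n => ?_) ?_
    · rw [hcriterion]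
      exact integral_nonneg fun t => by positivity
    · filter_upwards [eventually_ge_atTop 1] with n hn
      refine (hω₃ n hn θ₀).trans ?_
      rw [hcriterion]
      exact integral_norm_sub_sq_le_two_mul (continuous_empiricalChf _ _)
        (continuous_empiricalChf _ _) continuous_charFun (norm_empiricalChf_le _ _)
        (norm_empiricalChf_le _ _) (fun t => norm_charFun_le_one t)
  suffices hlim : ∀ᵐ ω ∂P, Tendsto (fun n => θhat n ω) atTop (𝓝 θ₀) by
    filter_upwards [hlim] with ω hω
    exact (continuous_subtype_val.tendsto θ₀).comp hω
  refine ae_tendsto_of_ae_eventually_notMem θhat θ₀ fun θ hθ => ?_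
  obtain ⟨s, hs⟩ : ∃ s, charFun (ν θ) s ≠ charFun (ν θ₀) s := by
    by_contra! hcon
    exact hθ (hident θ hcon)
  set g : EuclideanSpace ℝ (Fin p) → ℂ :=
    fun t => (starRingEnd ℂ) (charFun (ν θ) t - charFun (ν θ₀) t) with hgdef
  have hg : Continuous g :=
    Complex.continuous_conj.comp (continuous_charFun.sub continuous_charFun)
  have hgC : ∀ t, ‖g t‖ ≤ 2 := fun t => by
    rw [hgdef, RCLike.norm_conj]
    linarith [norm_sub_le (charFun (ν θ) t) (charFun (ν θ₀) t),
      norm_charFun_le_one (μ := ν θ) t, norm_charFun_le_one (μ := ν θ₀) t]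
  have hf : Continuous (chfTest W g) := continuous_chfTest hg hgC
  -- a level strictly between the means of the test function under `θ₀` and under `θ`
  obtain ⟨c, hc₀, hc⟩ := exists_between (integral_chfTest_lt (W := W) (ν θ₀) (ν θ) hs)
  have hpath : Measurable fun (x : Θ → EuclideanSpace ℝ (Fin p)) (θ : Θ) => chfTest W g (x θ) :=
    measurable_pi_lambda _ fun θ => hf.measurable.comp (measurable_pi_apply θ)
  obtain ⟨V, hV, hVae⟩ := exists_nhds_ae_eventually_lt_average (P := P)
    (fun j θ ω => chfTest W g (Xsim j θ ω))
    (fun j θ => hf.measurable.comp (hsimmeas j θ))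
    (hsimindep.comp (fun _ x θ => chfTest W g (x θ)) fun _ => hpath)
    (fun j => (hsimident j).comp hpath)
    (fun j θ ω => abs_chfTest_le hgC _)
    (fun j => (hsimcont j).mono fun ω hω => hf.comp hω) θ (c := c) (by
      rwa [← integral_map (hsimmeas 0 θ).aemeasurable hf.aestronglyMeasurable, hsimmap])
  refine ⟨V, hV, ?_⟩
  filter_upwards [hVae, hobs, hmin] with ω hωV hω₁ hω₂
  simp_rw [hcriterion] at hω₂
  have hav := tendsto_average_chfTest (ν θ₀) hg hgC (fun n => continuous_empiricalChf n _)
    (fun n => norm_empiricalChf_le n _) H (fun n j => Xsim j (θhat n ω) ω) hω₁ hω₂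
  filter_upwards [hH.eventually hωV, hav.eventually_lt_const hc₀] with n hn hn' hmem
  exact lt_asymm (hn _ hmem) hn'
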